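/- For an infinite word $\mathbf{u}=u_0u_1u_2\cdots$ over $\{a,b\}$, let $L_n(\mathbf{u})$ be the set of its factors of length $n$. The word $\mathbf{u}$ is Sturmian if $\#L_n(\mathbf{u})=n+1$ for all $n\ge 0$, and $a$-Sturmian if moreover $aa$ is a factor of it. Its abelian complexity $\rho^{ab}_{\mathbf{u}}(n)$ is the number of distinct Parikh vectors $(|w|_a,|w|_b)$, $w\in L_n(\mathbf{u})$. Let $\mathbf{v}$ be an $a$-Sturmian word over $\{a,b\}$, written in the form $$\mathbf{v}=a^{l_0}\,b\,a^{l+\epsilon_1}\,b\,a^{l+\epsilon_2}\,b\,a^{l+\epsilon_3}\,b\cdots,\qquad l_0,l\ge 0\text{ integers},\ \epsilon_i\in\{0,1\}.$$ Let $F$ be the cellular automaton with window length $l+1$ and local rule $a^{l+1}\mapsto a$, $w\mapsto b$ for every other $w\in\{a,b\}^{l+1}$; that is, the $n$-th letter of $F(\mathbf{v})$ is $a$ if $v_nv_{n+1}\cdots v_{n+l}=a^{l+1}$, and $b$ otherwise. **Theorem.** There is a largest integer $k_0$ such that $(a^{l}b)^{k_0}$ is a factor of $\mathbf{v}$. Put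 $n_0=k_0(l+1)$. Then $n_0>l$, and for every integer $n\ge 1$: 1. if $n\le n_0-l$, then $\rho^{ab}_{F(\mathbf{v})}(n)=2$; 2. if $n_0-l+1\le n\le n_0$, then $\rho^{ab}_{F(\mathbf{v})}(n)=3$; 3. if $n>n_0$, then $\rho^{ab}_{F(\mathbf{v})}(n)\in\{2,3\}$. -/

import Mathlib

namespace SturmianCA

/-- The set `L_n(u)` of factors of length `n` of an infinite word `u = u_0 u_1 u_2 ...`. -/
def factorsOfLength {A : Type*} (u : ℕ → A) (n : ℕ) : Set (List A) :=
  {w | ∃ i : ℕ, w = List.ofFn (fun j : Fin n => u (i + j))}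

/-- The set `L(u)` of all (finite) factors of `u`. -/
def factors {A : Type*} (u : ℕ → A) : Set (List A) :=
  {w | ∃ n : ℕ, w ∈ factorsOfLength u n}

/-- The complexity function `p_u(n) = # L_n(u)`. -/
noncomputable def complexity {A : Type*} (u : ℕ → A) (n : ℕ) : ℕ :=
  (factorsOfLength u n).ncard

/-- The Parikh vector of a finite word: the number of occurrences of each letter. -/
def parikh {A : Type*} [DecidableEq A] (w : List A) : A → ℕ :=
  fun x => w.count x

/-- The abelian complexity: the number of Parikh vectors of factors of length `n` of `u`. -/
noncomputable def abelianComplexity {A : Type*} [DecidableEq A] (u : ℕ → A) (n : ℕ) : ℕ :=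
  (parikh '' factorsOfLength u n).ncard

/-- The power `w^k` of a finite word. -/
def wordPow {A : Type*} (w : List A) (k : ℕ) : List A :=
  (List.replicate k w).flatten

/-- The image of an infinite word under the cellular automaton with local rule
`f : A^r → B`, that is `F(u) = f(u_0 ... u_{r-1}) f(u_1 ... u_r) f(u_2 ... u_{r+1}) ...`. -/
def cellularAutomaton {A B : Type*} {r : ℕ} (f : (Fin r → A) → B) (u : ℕ → A) : ℕ → B :=
  fun n => f (fun j => u (n + j))

/-- The alphabet `{a, b}`. -/
inductive Letter : Type
  | a : Letter
  | b : Letter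
  deriving DecidableEq

/-- An infinite word over `{a, b}` is Sturmian if `p_u(n) = n + 1` for all `n`. -/
def IsSturmian (u : ℕ → Letter) : Prop :=
  ∀ n : ℕ, complexity u n = n + 1

/-- A Sturmian word is `a`-Sturmian if it contains `aa`. -/
def IsASturmian (u : ℕ → Letter) : Prop :=
  IsSturmian u ∧ [Letter.a, Letter.a] ∈ factors u

/-- The finite word `a^m b`. -/
def block (m : ℕ) : List Letter :=
  List.replicate m Letter.a ++ [Letter.b]

/-- `v = a^{l₀} b a^{l + ε 0} b a^{l + ε 1} b a^{l + ε 2} b ...`: the concatenation of `a^{l₀} b`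
with the first `N` of the following blocks is a prefix of `v`, for every `N`. -/
def HasBlockForm (v : ℕ → Letter) (l₀ l : ℕ) (ε : ℕ → Fin 2) : Prop :=
  ∀ N : ℕ, ∃ n : ℕ,
    block l₀ ++ ((List.range N).map (fun i => block (l + (ε i : ℕ)))).flatten =
      List.ofFn (fun j : Fin n => v j)

/-- The local rule on `{a, b}^r` sending `a^r` to `a` and all other words to `b`. -/
def powerRule (r : ℕ) (w : Fin r → Letter) : Letter :=
  if ∀ j, w j = Letter.a then Letter.a else Letter.b

end SturmianCA

namespace SturmianCA

/-! Past the initial block, the letter `a` of the image marks exactly the starts of the long blocks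
a^{l+1} b. So the number of `a` in a window counts the long blocks starting there, and `bPos_add`
expresses distances between blocks through `ε`. The theorem becomes one about the exponent sequence
`ε`.

Sturmian words are balanced (`IsSturmian.count_add_le`). Balance passes to `ε`
(`HasBlockForm.longCount_add_le`), and `ε` is not eventually periodic because `v` is not. Balance of
`ε` keeps the numbers of `a` in windows of one length within 2 of each other
(`HasBlockForm.caCount_add_le`), hence at most three values; aperiodicity gives at least two
(`HasBlockForm.exists_caCount_ne`).

Let K be the greatest length of a run of zeros in `ε`. The block before such a run also ends in a^l
b, so k₀ = K + 1. The run is enclosed by ones, which gives n₀ = (K + 1)(l + 1) consecutive letters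
`b` in the image, so for 1 ≤ n ≤ n₀ the values 0 and 1 occur. Balance against K zeros forces ones of
`ε` to be at least K indices apart, and distance K occurs. Two letters `a` of the image are then K(l
+ 1) + 1 = n₀ - l apart at the closest, so the value 2 first occurs at n = n₀ - l + 1. -/

/-- The factor of length `n` of `u` at position `i`. -/
def word {A : Type*} (u : ℕ → A) (i n : ℕ) : List A :=
  List.ofFn (fun j : Fin n => u (i + j))

/-- `u` is eventually periodic. -/
def EventuallyPeriodic {A : Type*} (u : ℕ → A) : Prop :=
  ∃ M p : ℕ, 0 < p ∧ ∀ k, M ≤ k → u (k + p) = u k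

/-! ### Factors, determinism and eventual periodicity. -/

section Words

variable {A : Type*} (u : ℕ → A)

theorem word_eq_iff (i j n : ℕ) :
    word u i n = word u j n ↔ ∀ k < n, u (i + k) = u (j + k) := by
  unfold word
  rw [List.ofFn_inj, funext_iff]
  exact ⟨fun h k hk => h ⟨k, hk⟩, fun h k => h k k.2⟩

theorem factorsOfLength_eq_range (n : ℕ) :
    factorsOfLength u n = Set.range (fun i => word u i n) := by
  ext w
  simp only [factorsOfLength, word, Set.mem_ofPred_eq, Set.mem_range, eq_comm]

theorem word_mem_factorsOfLength (i n : ℕ) : word u i n ∈ factorsOfLength u n := ⟨i, rfl⟩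

theorem factorsOfLength_finite [Finite A] (n : ℕ) : (factorsOfLength u n).Finite := by
  refine (List.finite_length_eq A n).subset ?_
  rintro w ⟨i, rfl⟩
  simp

theorem word_succ_eq_iff (i j n : ℕ) :
    word u i (n + 1) = word u j (n + 1) ↔ word u i n = word u j n ∧ u (i + n) = u (j + n) := by
  simp only [word_eq_iff]
  constructor
  · exact fun h => ⟨fun k hk => h k (by omega), h n (by omega)⟩
  · rintro ⟨h, h'⟩ k hk
    rcases Nat.lt_succ_iff_lt_or_eq.1 hk with hk | rfl
    · exact h k hk
    · exact h'

theorem word_succ_eq_iff' (i j n : ℕ) :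
    word u i (n + 1) = word u j (n + 1) ↔
      u i = u j ∧ word u (i + 1) n = word u (j + 1) n := by
  simp only [word_eq_iff]
  constructor
  · refine fun h => ⟨h 0 (by omega), fun k hk => ?_⟩
    have := h (k + 1) (by omega)
    rwa [show i + 1 + k = i + (k + 1) by omega, show j + 1 + k = j + (k + 1) by omega]
  · rintro ⟨h, h'⟩ k hk
    rcases k with _ | k
    · exact h
    · have := h' k (by omega)
      rwa [show i + 1 + k = i + (k + 1) by omega, show j + 1 + k = j + (k + 1) by omega] at this

theorem take_word (i n : ℕ) : (word u i (n + 1)).take n = word u i n := by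
  apply List.ext_getElem
  · simp [word]
  · intro k h1 h2
    rw [List.getElem_take]
    simp only [word, List.getElem_ofFn]

/-- If a word recurs and none of the factors in between can be continued in two ways, then the
sequence is eventually periodic. -/
theorem eventuallyPeriodic_of_deterministic {n s t : ℕ} (hst : s < t)
    (h : word u s n = word u t n)
    (hd : ∀ r, s ≤ r → r < t → ∀ r', s ≤ r' → word u r' n = word u r n → u (r' + n) = u (r + n)) :
    EventuallyPeriodic u := by
  -- The suffixes from `s` and from `t` run in step through the same cycle of factors, those at
  -- positions in [s, t).
  have key : ∀ k, ∃ r, s ≤ r ∧ r < t ∧ word u (s + k) n = word u r n ∧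
      word u (t + k) n = word u r n := by
    intro k
    induction k with
    | zero => exact ⟨s, le_rfl, hst, rfl, h.symm⟩
    | succ k ih =>
      obtain ⟨r, h1, h2, h3, h4⟩ := ih
      have e3 := hd r h1 h2 (s + k) (by omega) h3
      have e4 := hd r h1 h2 (t + k) (by omega) h4
      have f3 := ((word_succ_eq_iff' u _ _ _).1 ((word_succ_eq_iff u _ _ _).2 ⟨h3, e3⟩)).2
      have f4 := ((word_succ_eq_iff' u _ _ _).1 ((word_succ_eq_iff u _ _ _).2 ⟨h4, e4⟩)).2
      rcases Nat.lt_or_ge (r + 1) t with hr | hr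
      · exact ⟨r + 1, by omega, hr, f3, f4⟩
      · obtain rfl : r + 1 = t := by omega
        exact ⟨s, le_rfl, hst, f3.trans h.symm, f4.trans h.symm⟩
  refine ⟨s + n, t - s, by omega, fun k hk => ?_⟩
  obtain ⟨r, h1, h2, h3, h4⟩ := key (k - s - n)
  have e3 := hd r h1 h2 (s + (k - s - n)) (by omega) h3
  have e4 := hd r h1 h2 (t + (k - s - n)) (by omega) h4
  rw [show s + (k - s - n) + n = k by omega] at e3
  rw [show t + (k - s - n) + n = k + (t - s) by omega] at e4
  rw [e3, e4]

/-- The theorem of Morse and Hedlund. -/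
theorem eventuallyPeriodic_of_complexity_le [Finite A] {n : ℕ} (h : complexity u n ≤ n) :
    EventuallyPeriodic u := by
  -- If the complexity increased at every step it would exceed `n` at `n`. Where it does not
  -- increase, each factor has a unique right extension.
  obtain ⟨k, hk⟩ : ∃ k, complexity u (k + 1) ≤ complexity u k := by
    by_contra! hc
    have : ∀ k, k + 1 ≤ complexity u k := by
      intro k
      induction k with
      | zero =>
        exact (Set.ncard_pos (factorsOfLength_finite u 0)).2 ⟨_, word_mem_factorsOfLength u 0 0⟩
      | succ k ih => have := hc k; omega
    have := this n
    omega
  have hinj : Set.InjOn (List.take k) (factorsOfLength u (k + 1)) := by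
    refine Set.injOn_of_ncard_image_eq ?_ (factorsOfLength_finite u _)
    have himg : List.take k '' factorsOfLength u (k + 1) = factorsOfLength u k := by
      rw [factorsOfLength_eq_range, factorsOfLength_eq_range, ← Set.range_comp]
      congr 1
      ext1 i
      exact take_word u i k
    apply le_antisymm (Set.ncard_image_le (factorsOfLength_finite u _))
    rw [himg]
    exact hk
  have : Finite (factorsOfLength u k) := factorsOfLength_finite u k
  obtain ⟨s, t, hne, hst⟩ := Finite.exists_ne_map_eq_of_infinite
    (fun i : ℕ => (⟨word u i k, word_mem_factorsOfLength u i k⟩ : factorsOfLength u k))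
  have hst : word u s k = word u t k := congrArg Subtype.val hst
  have hd : ∀ r r', word u r' k = word u r k → u (r' + k) = u (r + k) := by
    intro r r' hr
    rw [← take_word u r', ← take_word u r] at hr
    exact ((word_succ_eq_iff u _ _ _).1 (hinj (word_mem_factorsOfLength u _ _)
      (word_mem_factorsOfLength u _ _) hr)).2
  rcases Nat.lt_or_gt_of_ne hne with hlt | hlt
  · exact eventuallyPeriodic_of_deterministic u hlt hst fun r _ _ r' _ => hd r r'
  · exact eventuallyPeriodic_of_deterministic u hlt hst.symm fun r _ _ r' _ => hd r r'

theorem complexity_le_of_eventuallyPeriodic (h : EventuallyPeriodic u) :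
    ∃ C, ∀ n, complexity u n ≤ C := by
  obtain ⟨M, p, hp, h⟩ := h
  have key : ∀ i, ∃ j < M + p, ∀ k, u (i + k) = u (j + k) := by
    intro i
    induction i using Nat.strong_induction_on with
    | _ i ih =>
      rcases Nat.lt_or_ge i (M + p) with hi | hi
      · exact ⟨i, hi, fun _ => rfl⟩
      · obtain ⟨j, hj, hk⟩ := ih (i - p) (by omega)
        refine ⟨j, hj, fun k => ?_⟩
        rw [← hk k, ← h (i - p + k) (by omega)]
        congr 1
        omega
  refine ⟨M + p, fun n => ?_⟩
  have hsub : factorsOfLength u n ⊆ (fun i => word u i n) '' (Finset.range (M + p) : Set ℕ) := by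
    rw [factorsOfLength_eq_range]
    rintro _ ⟨i, rfl⟩
    obtain ⟨j, hj, hk⟩ := key i
    exact ⟨j, by simpa using hj, ((word_eq_iff u i j n).2 fun k _ => hk k).symm⟩
  calc complexity u n ≤ _ := Set.ncard_le_ncard hsub ((Finset.finite_toSet _).image _)
    _ ≤ (Finset.range (M + p) : Set ℕ).ncard := Set.ncard_image_le (Finset.finite_toSet _)
    _ = M + p := by rw [Set.ncard_coe_finset, Finset.card_range]

end Words

instance : Finite Letter :=
  Finite.of_injective (fun x : Letter => decide (x = Letter.a)) (by
    intro x y h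
    cases x <;> cases y <;> simp_all)

theorem Letter.eq_of_ne_of_ne {x y z : Letter} (h : x ≠ y) (h' : z ≠ y) : z = x := by
  cases x <;> cases y <;> cases z <;> simp_all

theorem Letter.eq_of_eq_b_iff {x y : Letter} (h : x = Letter.b ↔ y = Letter.b) : x = y := by
  cases x <;> cases y <;> simp_all

/-! ### Recurrence, right special factors and balance of Sturmian words. -/

section Sturmian

variable {u : ℕ → Letter}

theorem IsSturmian.not_eventuallyPeriodic (hu : IsSturmian u) : ¬ EventuallyPeriodic u := by
  intro h
  obtain ⟨C, hC⟩ := complexity_le_of_eventuallyPeriodic u h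
  have := hC C
  rw [hu C] at this
  omega

/-- Sturmian words are recurrent. -/
theorem IsSturmian.exists_word_eq (hu : IsSturmian u) (i n M : ℕ) :
    ∃ j, M ≤ j ∧ word u j n = word u i n := by
  by_contra! hc
  have hw : ∀ j m, word (fun k => u (M + k)) j m = word u (M + j) m := fun j m => by
    simp [word, Nat.add_assoc]
  -- A factor absent after `M` leaves that suffix at most n of the n + 1 factors of length n.
  have hper : EventuallyPeriodic (fun k => u (M + k)) := by
    apply eventuallyPeriodic_of_complexity_le (n := n)
    have hss : factorsOfLength (fun k => u (M + k)) n ⊂ factorsOfLength u n := by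
      rw [Set.ssubset_iff_of_subset]
      · refine ⟨word u i n, word_mem_factorsOfLength u i n, ?_⟩
        rw [factorsOfLength_eq_range]
        rintro ⟨j, hj⟩
        exact hc (M + j) (by omega) ((hw j n).symm.trans hj)
      · rw [factorsOfLength_eq_range]
        rintro _ ⟨j, rfl⟩
        simp only [hw]
        exact word_mem_factorsOfLength u _ _
    have := Set.ncard_lt_ncard hss (factorsOfLength_finite u n)
    have h2 := hu n
    unfold complexity at h2 ⊢
    omega
  obtain ⟨N, p, hp, h⟩ := hper
  refine hu.not_eventuallyPeriodic ⟨M + N, p, hp, fun k hk => ?_⟩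
  have := h (k - M) (by omega)
  simp only at this
  rwa [show M + (k - M + p) = k + p by omega, show M + (k - M) = k by omega] at this

/-- A Sturmian word has at most one right special factor of each length. -/
theorem IsSturmian.word_eq_of_rightSpecial (hu : IsSturmian u) {n i i' j j' : ℕ}
    (hi : word u i n = word u i' n) (hi' : u (i + n) ≠ u (i' + n))
    (hj : word u j n = word u j' n) (hj' : u (j + n) ≠ u (j' + n)) :
    word u i n = word u j n := by
  by_contra hne
  set P : Set (List Letter) := {word u i' (n + 1), word u j' (n + 1)} with hP
  have hPsub : P ⊆ factorsOfLength u (n + 1) := by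
    rintro w (rfl | rfl) <;> exact word_mem_factorsOfLength u _ _
  have hPcard : P.ncard = 2 := by
    apply Set.ncard_pair
    intro h
    have := ((word_succ_eq_iff u _ _ _).1 h).1
    exact hne (hi.trans (this.trans hj.symm))
  -- With two right special factors, one extension of each can be discarded and every factor still
  -- extends: n + 1 ≤ (n + 2) - 2.
  have hsub : factorsOfLength u n ⊆ List.take n '' (factorsOfLength u (n + 1) \ P) := by
    rw [factorsOfLength_eq_range u n]
    rintro _ ⟨r, rfl⟩
    obtain ⟨s, hs1, hs2⟩ : ∃ s, word u s n = word u r n ∧ word u s (n + 1) ∉ P := by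
      by_cases h1 : word u r n = word u i n
      · refine ⟨i, h1.symm, ?_⟩
        rintro (h | h)
        · exact hi' ((word_succ_eq_iff u _ _ _).1 h).2
        · exact hne (((word_succ_eq_iff u _ _ _).1 h).1.trans hj.symm)
      by_cases h2 : word u r n = word u j n
      · refine ⟨j, h2.symm, ?_⟩
        rintro (h | h)
        · exact hne (hi.trans ((word_succ_eq_iff u _ _ _).1 h).1.symm)
        · exact hj' ((word_succ_eq_iff u _ _ _).1 h).2
      refine ⟨r, rfl, ?_⟩
      rintro (h | h)
      · exact h1 (((word_succ_eq_iff u _ _ _).1 h).1.trans hi.symm)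
      · exact h2 (((word_succ_eq_iff u _ _ _).1 h).1.trans hj.symm)
    exact ⟨word u s (n + 1), ⟨word_mem_factorsOfLength u _ _, hs2⟩, (take_word u s n).trans hs1⟩
  have hfin := factorsOfLength_finite u (n + 1)
  have h1 := (Set.ncard_le_ncard hsub (hfin.sdiff.image _)).trans (Set.ncard_image_le hfin.sdiff)
  rw [Set.ncard_sdiff hPsub (hfin.subset hPsub), hPcard] at h1
  have h2 := hu n
  have h3 := hu (n + 1)
  unfold complexity at h2 h3
  omega

/-- In a Sturmian word there is no palindrome `w` such that, with `x, y` the two letters, `xwx` and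
`ywy` are factors, and `yw` is not right special. -/
theorem IsSturmian.false_of_palindrome (hu : IsSturmian u) {p q m : ℕ} (hne : u p ≠ u q)
    (hw : word u (p + 1) m = word u (q + 1) m)
    (hp : u (p + (m + 1)) = u p) (hq : u (q + (m + 1)) = u q)
    (hpal : ∀ k ≤ m + 1, u (q + k) = u (q + (m + 1 - k)))
    (hns : ∀ r, word u r (m + 1) = word u q (m + 1) → u (r + (m + 1)) = u (q + (m + 1))) :
    False := by
  -- Write x = u p, y = u q. If xw occurred at q + t, the final y of ywy would be a letter of that
  -- w, whose mirror image in the palindrome is the x at q + t.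
  have h1 : ∀ t ≤ m + 1, word u (q + t) (m + 1) ≠ word u p (m + 1) := by
    intro t ht h
    obtain ⟨h1, h2⟩ := (word_succ_eq_iff' u _ _ _).1 h
    rw [hw, word_eq_iff] at h2
    rcases Nat.eq_zero_or_pos t with rfl | htpos
    · exact hne h1.symm
    rcases ht.eq_or_lt with rfl | htlt
    · exact hne (h1.symm.trans hq)
    · have := h2 (m - t) (by omega)
      rw [show q + t + 1 + (m - t) = q + (m + 1) by omega, hq,
        show q + 1 + (m - t) = q + (m + 1 - t) by omega, ← hpal t ht] at this
      exact hne (h1.symm.trans this.symm)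
  -- A right special factor of length m + 1 ends in the right special w, so it is xw or yw; `h1`
  -- excludes the first and `hns` the second.
  have h2 : ∀ t ≤ m + 1, ∀ r, word u r (m + 1) = word u (q + t) (m + 1) →
      u (r + (m + 1)) = u (q + t + (m + 1)) := by
    intro t ht r hr
    by_contra hc
    obtain ⟨e1, e2⟩ := (word_succ_eq_iff' u _ _ _).1 hr
    have hsp := hu.word_eq_of_rightSpecial e2
      (by rwa [show r + 1 + m = r + (m + 1) by omega,
        show q + t + 1 + m = q + t + (m + 1) by omega]) hw
      (by rwa [show p + 1 + m = p + (m + 1) by omega,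
        show q + 1 + m = q + (m + 1) by omega, hp, hq])
    by_cases hl : u (q + t) = u p
    · exact h1 t ht ((word_succ_eq_iff' u _ _ _).2 ⟨hl, e2.symm.trans hsp⟩)
    · have hl : u (q + t) = u q := Letter.eq_of_ne_of_ne hne.symm hl
      have e3 : word u (q + t) (m + 1) = word u q (m + 1) :=
        (word_succ_eq_iff' u _ _ _).2 ⟨hl, e2.symm.trans (hsp.trans hw)⟩
      exact hc ((hns r (hr.trans e3)).trans (hns _ e3).symm)
  -- Pigeonhole: m + 2 positions, but only m + 1 factors other than xw. A repetition without right
  -- special factors in between forces periodicity.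
  have hfin := factorsOfLength_finite u (m + 1)
  have hcard : (factorsOfLength u (m + 1) \ {word u p (m + 1)}).ncard <
      (Finset.range (m + 2) : Set ℕ).ncard := by
    rw [Set.ncard_sdiff_singleton_of_mem (word_mem_factorsOfLength u _ _), Set.ncard_coe_finset,
      Finset.card_range]
    have := hu (m + 1)
    unfold complexity at this
    omega
  obtain ⟨s, hs, t, ht, hst, he⟩ := Set.exists_ne_map_eq_of_ncard_lt_of_maps_to hcard
    (f := fun t => word u (q + t) (m + 1))
    (fun t ht => ⟨word_mem_factorsOfLength u _ _, h1 t (by simp at ht; omega)⟩) hfin.sdiff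
  simp only [Finset.coe_range, Set.mem_Iio] at hs ht
  have main : ∀ s t, s < t → t < m + 2 → word u (q + s) (m + 1) = word u (q + t) (m + 1) →
      False := by
    intro s t hst ht he
    refine hu.not_eventuallyPeriodic (eventuallyPeriodic_of_deterministic u
      (Nat.add_lt_add_left hst q) he ?_)
    intro r hr1 hr2 r' _ hr
    have := h2 (r - q) (by omega) r'
    rw [show q + (r - q) = r by omega] at this
    exact this hr
  rcases Nat.lt_or_gt_of_ne hst with h | h
  · exact main s t h ht he
  · exact main t s h hs he.symm

/-- Sturmian words are balanced. -/
theorem IsSturmian.count_add_le (hu : IsSturmian u) (i j n : ℕ) :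
    Nat.count (u · = Letter.b) (i + n) + Nat.count (u · = Letter.b) j ≤
      Nat.count (u · = Letter.b) (j + n) + Nat.count (u · = Letter.b) i + 1 := by
  set C := Nat.count (u · = Letter.b) with hC
  have hstep : ∀ k, C (k + 1) = C k + if u k = Letter.b then 1 else 0 := fun k =>
    Nat.count_succ _ _
  induction n using Nat.strong_induction_on generalizing i j with
  | _ n hmin =>
  by_contra! h
  rcases n with _ | _ | m
  · simp only [Nat.add_zero] at h; omega
  · have h1 := hstep i
    have h2 := hstep j
    simp only [Nat.zero_add] at h
    split_ifs at h1 h2 <;> omega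
  -- In a shortest violation every proper prefix has excess exactly 1: prefix and remainder each
  -- have at most 1, the whole at least 2. Hence the windows are bwb and awa, and w will be a
  -- palindrome.
  have hD : ∀ k, 1 ≤ k → k ≤ m + 1 → C (i + k) + C j = C (j + k) + C i + 1 := by
    intro k hk1 hk2
    have h1 := hmin k (by omega) i j
    have h2 := hmin (m + 2 - k) (by omega) (i + k) (j + k)
    rw [show i + k + (m + 2 - k) = i + (m + 1 + 1) by omega,
      show j + k + (m + 2 - k) = j + (m + 1 + 1) by omega] at h2
    omega
  have hi0 : u i = Letter.b ∧ u j ≠ Letter.b := by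
    have h1 := hstep i
    have h2 := hstep j
    have h3 := hD 1 (by omega) (by omega)
    split_ifs at h1 h2 with h4 h5 <;> first | omega | exact ⟨h4, h5⟩
  have hi1 : u (i + (m + 1)) = Letter.b ∧ u (j + (m + 1)) ≠ Letter.b := by
    have h1 := hstep (i + (m + 1))
    have h2 := hstep (j + (m + 1))
    have h3 := hD (m + 1) (by omega) (by omega)
    rw [Nat.add_assoc] at h1 h2
    split_ifs at h1 h2 with h4 h5 <;> first | omega | exact ⟨h4, h5⟩
  have hend : C (i + (m + 2)) + C j = C (j + (m + 2)) + C i + 2 := by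
    have h1 := hstep (i + (m + 1))
    have h2 := hstep (j + (m + 1))
    have h3 := hD (m + 1) (by omega) (by omega)
    rw [Nat.add_assoc] at h1 h2
    rw [if_pos hi1.1] at h1
    rw [if_neg hi1.2] at h2
    simp only [Nat.add_assoc, Nat.reduceAdd] at *
    omega
  have hmid : ∀ k, 1 ≤ k → k ≤ m → u (i + k) = u (j + k) := by
    intro k hk1 hk2
    have h1 := hstep (i + k)
    have h2 := hstep (j + k)
    have h3 := hD k (by omega) (by omega)
    have h4 := hD (k + 1) (by omega) (by omega)
    rw [Nat.add_assoc] at h1 h2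
    apply Letter.eq_of_eq_b_iff
    split_ifs at h1 h2 <;> first | omega | simp_all
  -- Comparing prefixes of one window with suffixes of the other, by minimality, shows that the
  -- prefix and suffix of length k of awa contain equally many `b`.
  have hsym : ∀ k, k ≤ m + 2 → C (j + k) + C (j + (m + 2 - k)) = C (j + (m + 2)) + C j := by
    intro k hk
    rcases Nat.eq_zero_or_pos k with rfl | hk0
    · simp [Nat.add_comm]
    rcases hk.eq_or_lt with rfl | hk1
    · simp
    have h1 := hmin k (by omega) i (j + (m + 2 - k))
    have h2 := hmin k (by omega) (i + (m + 2 - k)) j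
    rw [show j + (m + 2 - k) + k = j + (m + 2) by omega] at h1
    rw [show i + (m + 2 - k) + k = i + (m + 2) by omega] at h2
    have h3 := hD k (by omega) (by omega)
    have h4 := hD (m + 2 - k) (by omega) (by omega)
    omega
  have hpal : ∀ k ≤ m + 1, u (j + k) = u (j + (m + 1 - k)) := by
    intro k hk
    have h1 := hsym k (by omega)
    have h2 := hsym (k + 1) (by omega)
    have h3 := hstep (j + k)
    have h4 := hstep (j + (m + 1 - k))
    rw [Nat.add_assoc] at h3 h4
    rw [show m + 1 - k + 1 = m + 2 - k by omega] at h4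
    rw [show m + 2 - (k + 1) = m + 1 - k by omega] at h2
    apply Letter.eq_of_eq_b_iff
    split_ifs at h3 h4 <;> first | omega | simp_all
  have hpal' : ∀ k ≤ m + 1, u (i + k) = u (i + (m + 1 - k)) := by
    intro k hk
    rcases Nat.eq_zero_or_pos k with rfl | hk0
    · simp [hi0.1, hi1.1]
    rcases hk.eq_or_lt with rfl | hk1
    · simp [hi0.1, hi1.1]
    rw [hmid k (by omega) (by omega), hmid (m + 1 - k) (by omega) (by omega)]
    exact hpal k hk
  have hw : word u (i + 1) m = word u (j + 1) m := by
    rw [word_eq_iff]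
    intro k hk
    have := hmid (k + 1) (by omega) (by omega)
    rwa [show i + 1 + k = i + (k + 1) by omega, show j + 1 + k = j + (k + 1) by omega]
  have hne : u i ≠ u j := fun h => hi0.2 (h ▸ hi0.1)
  have hi2 : u (i + (m + 1)) = u i := hi1.1.trans hi0.1.symm
  have hj2 : u (j + (m + 1)) = u j := Letter.eq_of_ne_of_ne hi0.2 hi1.2
  -- Of aw and bw at most one is right special; the other one feeds the palindrome lemma.
  by_cases hns : ∀ r, word u r (m + 1) = word u j (m + 1) → u (r + (m + 1)) = u (j + (m + 1))
  · exact hu.false_of_palindrome hne hw hi2 hj2 hpal hns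
  by_cases hns' : ∀ r, word u r (m + 1) = word u i (m + 1) → u (r + (m + 1)) = u (i + (m + 1))
  · exact hu.false_of_palindrome hne.symm hw.symm hj2 hi2 hpal' hns'
  push Not at hns hns'
  obtain ⟨r, hr1, hr2⟩ := hns
  obtain ⟨s, hs1, hs2⟩ := hns'
  have := hu.word_eq_of_rightSpecial hr1 hr2 hs1 hs2
  rw [hr1, hs1] at this
  exact hne ((word_succ_eq_iff' u _ _ _).1 this).1.symm

end Sturmian

/-! ### Block coordinates, balance of the exponents, and powers of a^l b. -/

/-- The number of long blocks `a^{l+1} b` among the first `i` blocks. -/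
def longCount (ε : ℕ → Fin 2) (i : ℕ) : ℕ := ∑ t ∈ Finset.range i, (ε t : ℕ)

/-- The position of the letter `b` that precedes the `i`-th block. -/
def bPos (l₀ l : ℕ) (ε : ℕ → Fin 2) (i : ℕ) : ℕ := l₀ + i * (l + 1) + longCount ε i

section Words

variable {A : Type*} (u : ℕ → A)

theorem word_add (i m n : ℕ) : word u i (m + n) = word u i m ++ word u (i + m) n := by
  apply List.ext_getElem
  · simp [word]
  · intro k h1 h2
    rw [List.getElem_append]
    simp only [word, List.length_ofFn] at h1 h2 ⊢
    split_ifs with h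
    · simp only [List.getElem_ofFn]
    · simp only [List.getElem_ofFn]
      congr 1
      omega

theorem length_word (i n : ℕ) : (word u i n).length = n := by simp [word]

theorem word_one (i : ℕ) : word u i 1 = [u i] := by simp [word]

theorem mem_factors_iff (w : List A) : w ∈ factors u ↔ ∃ i, word u i w.length = w := by
  constructor
  · rintro ⟨n, i, rfl⟩
    exact ⟨i, by simp [word]⟩
  · rintro ⟨i, h⟩
    exact ⟨w.length, i, h.symm⟩

theorem count_word [DecidableEq A] (x : A) (i n : ℕ) :
    (word u i n).count x + Nat.count (u · = x) i = Nat.count (u · = x) (i + n) := by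
  induction n with
  | zero => simp [word]
  | succ n ih =>
    rw [word_add, List.count_append, word_one, ← Nat.add_assoc, Nat.count_succ, ← ih,
      List.count_singleton]
    simp only [beq_iff_eq]
    omega

end Words

theorem length_block (m : ℕ) : (block m).length = m + 1 := by simp [block]

theorem word_eq_block_iff (v : ℕ → Letter) (x m : ℕ) :
    word v x (m + 1) = block m ↔ (∀ j < m, v (x + j) = Letter.a) ∧ v (x + m) = Letter.b := by
  have h1 : word v x m = List.replicate m Letter.a ↔ ∀ j < m, v (x + j) = Letter.a := by
    rw [List.eq_replicate_iff, word, List.forall_mem_ofFn_iff]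
    simp [Fin.forall_iff]
  rw [word_add, word_one, block, ← h1]
  constructor
  · intro h
    obtain ⟨h2, h3⟩ := List.append_inj' h rfl
    exact ⟨h2, by simpa using h3⟩
  · rintro ⟨h2, h3⟩
    rw [h2, h3]

section Positions

variable (l₀ l : ℕ) (ε : ℕ → Fin 2)

theorem longCount_succ (i : ℕ) : longCount ε (i + 1) = longCount ε i + (ε i : ℕ) :=
  Finset.sum_range_succ _ _

theorem longCount_mono : Monotone (longCount ε) :=
  monotone_nat_of_le_succ fun i => by rw [longCount_succ]; omega

theorem bPos_zero : bPos l₀ l ε 0 = l₀ := by simp [bPos, longCount]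

theorem bPos_succ (i : ℕ) : bPos l₀ l ε (i + 1) = bPos l₀ l ε i + (l + 1) + (ε i : ℕ) := by
  simp only [bPos, longCount_succ, Nat.add_mul]
  omega

theorem bPos_add (i N : ℕ) :
    bPos l₀ l ε (i + N) + longCount ε i = bPos l₀ l ε i + N * (l + 1) + longCount ε (i + N) := by
  simp only [bPos, Nat.add_mul]
  omega

theorem bPos_strictMono : StrictMono (bPos l₀ l ε) :=
  strictMono_nat_of_lt_succ fun i => by rw [bPos_succ]; omega

theorem exists_bPos_le_lt {n : ℕ} (hn : l₀ ≤ n) :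
    ∃ i, bPos l₀ l ε i ≤ n ∧ n < bPos l₀ l ε (i + 1) := by
  induction n, hn using Nat.le_induction with
  | base => exact ⟨0, by rw [bPos_zero], by rw [bPos_succ, bPos_zero]; omega⟩
  | succ n hn ih =>
    obtain ⟨i, h1, h2⟩ := ih
    rcases Nat.lt_or_ge (n + 1) (bPos l₀ l ε (i + 1)) with h | h
    · exact ⟨i, by omega, h⟩
    · exact ⟨i + 1, h, by rw [bPos_succ]; omega⟩

variable {l₀ l ε} {v : ℕ → Letter}

theorem HasBlockForm.prefix_eq (h : HasBlockForm v l₀ l ε) (N : ℕ) :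
    word v 0 (bPos l₀ l ε N + 1) =
      block l₀ ++ ((List.range N).map (fun i => block (l + (ε i : ℕ)))).flatten := by
  obtain ⟨n, hn⟩ := h N
  have hlen : bPos l₀ l ε N + 1 = n := by
    have := congrArg List.length hn
    rw [List.length_ofFn] at this
    rw [← this]
    clear this hn
    induction N with
    | zero => simp [bPos_zero, length_block]
    | succ N ih =>
      rw [bPos_succ, List.range_succ, List.map_append, List.flatten_append, ← List.append_assoc,
        List.length_append, ← ih]
      simp [length_block]
      omega
  rw [hn, hlen]
  simp [word]

theorem HasBlockForm.letter_init (h : HasBlockForm v l₀ l ε) : v l₀ = Letter.b := by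
  have := h.prefix_eq 0
  rw [bPos_zero] at this
  simp only [List.range_zero, List.map_nil, List.flatten_nil, List.append_nil] at this
  have := ((word_eq_block_iff v 0 l₀).1 this).2
  rwa [Nat.zero_add] at this

theorem HasBlockForm.word_block (h : HasBlockForm v l₀ l ε) (i : ℕ) :
    word v (bPos l₀ l ε i + 1) (l + (ε i : ℕ) + 1) = block (l + (ε i : ℕ)) := by
  have h1 := h.prefix_eq (i + 1)
  rw [List.range_succ, List.map_append, List.flatten_append, ← List.append_assoc, ← h.prefix_eq i,
    show bPos l₀ l ε (i + 1) + 1 = (bPos l₀ l ε i + 1) + (l + (ε i : ℕ) + 1) by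
      rw [bPos_succ]; omega, word_add] at h1
  have := (List.append_inj h1 rfl).2
  simpa using this

theorem HasBlockForm.letter_bPos (h : HasBlockForm v l₀ l ε) (i : ℕ) :
    v (bPos l₀ l ε i) = Letter.b := by
  rcases i with _ | i
  · rw [bPos_zero]; exact h.letter_init
  · have := ((word_eq_block_iff v _ _).1 (h.word_block i)).2
    rw [bPos_succ]
    rwa [show bPos l₀ l ε i + 1 + (l + (ε i : ℕ)) = bPos l₀ l ε i + (l + 1) + (ε i : ℕ) by
      omega] at this

theorem HasBlockForm.letter_between (h : HasBlockForm v l₀ l ε) {i n : ℕ}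
    (h1 : bPos l₀ l ε i < n) (h2 : n < bPos l₀ l ε (i + 1)) : v n = Letter.a := by
  rw [bPos_succ] at h2
  have := ((word_eq_block_iff v _ _).1 (h.word_block i)).1 (n - bPos l₀ l ε i - 1) (by omega)
  rwa [show bPos l₀ l ε i + 1 + (n - bPos l₀ l ε i - 1) = n by omega] at this

theorem HasBlockForm.exists_eq_bPos (h : HasBlockForm v l₀ l ε) {n : ℕ} (hn : l₀ ≤ n)
    (hb : v n = Letter.b) : ∃ i, n = bPos l₀ l ε i := by
  obtain ⟨i, h1, h2⟩ := exists_bPos_le_lt l₀ l ε hn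
  rcases h1.eq_or_lt with h1 | h1
  · exact ⟨i, h1.symm⟩
  · rw [h.letter_between h1 h2] at hb
    cases hb

theorem HasBlockForm.count_bPos (h : HasBlockForm v l₀ l ε) (i : ℕ) :
    Nat.count (v · = Letter.b) (bPos l₀ l ε i) =
      Nat.count (v · = Letter.b) l₀ + i := by
  induction i with
  | zero => rw [bPos_zero, Nat.add_zero]
  | succ i ih =>
    have key : ∀ j ≤ l + (ε i : ℕ), Nat.count (v · = Letter.b) (bPos l₀ l ε i + 1 + j) =
        Nat.count (v · = Letter.b) l₀ + i + 1 := by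
      intro j
      induction j with
      | zero =>
        intro _
        rw [Nat.add_zero, Nat.count_succ, if_pos (h.letter_bPos i), ih]
      | succ j ihj =>
        intro hj
        have ha : v (bPos l₀ l ε i + 1 + j) = Letter.a :=
          h.letter_between (i := i) (by omega) (by rw [bPos_succ]; omega)
        rw [← Nat.add_assoc, Nat.count_succ, ihj (by omega), if_neg (by rw [ha]; simp)]
    have := key (l + (ε i : ℕ)) le_rfl
    rw [bPos_succ]
    rwa [show bPos l₀ l ε i + 1 + (l + (ε i : ℕ)) = bPos l₀ l ε i + (l + 1) + (ε i : ℕ) by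
      omega] at this

/-- The sequence of exponents of a Sturmian word is balanced. -/
theorem HasBlockForm.longCount_add_le (h : HasBlockForm v l₀ l ε) (hv : IsSturmian v)
    (i j N : ℕ) :
    longCount ε (i + N) + longCount ε j ≤ longCount ε (j + N) + longCount ε i + 1 := by
  by_contra! hc
  have hi := bPos_add l₀ l ε i N
  have hj := bPos_add l₀ l ε j N
  have hjm := (bPos_strictMono l₀ l ε).monotone (Nat.le_add_right j N)
  obtain ⟨d, hd⟩ := Nat.exists_eq_add_of_le hjm
  -- The window from the `b` of index j to that of index j + N, ends included, has N + 1 letters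
  -- `b`. One of equal length fits strictly between those of indices i and i + N, where there are N
  -- - 1.
  have hbal := hv.count_add_le (bPos l₀ l ε j) (bPos l₀ l ε i + 1) (d + 1)
  rw [← Nat.add_assoc, ← hd, Nat.count_succ, if_pos (h.letter_bPos _), Nat.count_succ,
    if_pos (h.letter_bPos _)] at hbal
  have hmono := Nat.count_monotone (v · = Letter.b)
    (show bPos l₀ l ε i + 1 + (d + 1) ≤ bPos l₀ l ε (i + N) by omega)
  simp only [h.count_bPos] at hbal hmono
  omega

/-- The exponents are the gaps between successive letters `b`, up to a constant, so a period of `ε`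
would give one of `v`. -/
theorem HasBlockForm.not_eventuallyPeriodic (h : HasBlockForm v l₀ l ε) (hv : IsSturmian v) :
    ¬ EventuallyPeriodic ε := by
  rintro ⟨M, q, hq, hper⟩
  have hmono := bPos_strictMono l₀ l ε
  obtain ⟨T, hT⟩ := Nat.exists_eq_add_of_lt (hmono (Nat.lt_add_of_pos_right (n := M) hq))
  have key : ∀ i, M ≤ i → bPos l₀ l ε (i + q) = bPos l₀ l ε i + (T + 1) := by
    intro i hi
    induction i, hi using Nat.le_induction with
    | base => exact hT
    | succ i hi ih =>
      rw [show i + 1 + q = i + q + 1 by omega, bPos_succ, bPos_succ, ih, hper i hi]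
      omega
  have hM : l₀ ≤ bPos l₀ l ε M := by
    conv_lhs => rw [← bPos_zero l₀ l ε]
    exact hmono.monotone (Nat.zero_le M)
  refine hv.not_eventuallyPeriodic ⟨bPos l₀ l ε M, T + 1, by omega, fun k hk => ?_⟩
  apply Letter.eq_of_eq_b_iff
  constructor
  · intro hb
    obtain ⟨i, hi⟩ := h.exists_eq_bPos (by omega) hb
    have hi2 : M + q ≤ i := by
      rw [← hmono.le_iff_le, ← hi, hT]
      omega
    have := key (i - q) (by omega)
    rw [show i - q + q = i by omega, ← hi] at this
    rw [show k = bPos l₀ l ε (i - q) by omega]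
    exact h.letter_bPos _
  · intro hb
    obtain ⟨i, rfl⟩ := h.exists_eq_bPos (by omega) hb
    rw [← key i (hmono.le_iff_le.1 hk)]
    exact h.letter_bPos _

theorem HasBlockForm.exponent_eq_zero (h : HasBlockForm v l₀ l ε) {i : ℕ}
    (hb : v (bPos l₀ l ε i + (l + 1)) = Letter.b) : (ε i : ℕ) = 0 := by
  by_contra hne
  rw [h.letter_between (i := i) (by omega) (by rw [bPos_succ]; omega)] at hb
  cases hb

/-- The runs of short blocks `a^l b` recur. -/
theorem HasBlockForm.exists_longCount_add_eq (h : HasBlockForm v l₀ l ε) (hv : IsSturmian v)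
    {r k : ℕ} (hr : longCount ε (r + k) = longCount ε r) (M : ℕ) :
    ∃ s, M ≤ s ∧ longCount ε (s + k) = longCount ε s := by
  have hmono := bPos_strictMono l₀ l ε
  obtain ⟨x, hx, hw⟩ := hv.exists_word_eq (bPos l₀ l ε r) (k * (l + 1) + 1) (bPos l₀ l ε M)
  rw [word_eq_iff] at hw
  -- A run of short blocks is recognised by letters `b` at spacing l + 1, which the copy at `x`
  -- inherits.
  have hb : ∀ t ≤ k, v (x + t * (l + 1)) = Letter.b := by
    intro t ht
    rw [hw _ (Nat.lt_succ_of_le (Nat.mul_le_mul_right _ ht))]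
    have h1 := bPos_add l₀ l ε r t
    have h2 := longCount_mono ε (show r + t ≤ r + k by omega)
    have h3 := longCount_mono ε (show r ≤ r + t by omega)
    rw [show bPos l₀ l ε r + t * (l + 1) = bPos l₀ l ε (r + t) by omega]
    exact h.letter_bPos _
  have hM : l₀ ≤ bPos l₀ l ε M := by
    conv_lhs => rw [← bPos_zero l₀ l ε]
    exact hmono.monotone (Nat.zero_le M)
  obtain ⟨s, hs⟩ := h.exists_eq_bPos (n := x) (by omega) (by simpa using hb 0 (Nat.zero_le k))
  refine ⟨s, by rwa [hs, hmono.le_iff_le] at hx, ?_⟩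
  have key : ∀ t ≤ k, longCount ε (s + t) = longCount ε s := by
    intro t
    induction t with
    | zero => intro _; rfl
    | succ t ih =>
      intro ht
      have ih := ih (by omega)
      have h1 := bPos_add l₀ l ε s t
      have h2 := hb (t + 1) ht
      rw [Nat.add_mul, Nat.one_mul, ← Nat.add_assoc, hs,
        show bPos l₀ l ε s + t * (l + 1) = bPos l₀ l ε (s + t) by omega] at h2
      rw [← Nat.add_assoc, longCount_succ, h.exponent_eq_zero h2, ih, Nat.add_zero]
  exact key k le_rfl

theorem wordPow_succ {A : Type*} (w : List A) (k : ℕ) :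
    wordPow w (k + 1) = w ++ wordPow w k := by
  simp [wordPow, List.replicate_succ]

theorem word_eq_append_iff {A : Type*} (u : ℕ → A) (i : ℕ) (x y : List A) :
    word u i (x ++ y).length = x ++ y ↔
      word u i x.length = x ∧ word u (i + x.length) y.length = y := by
  rw [List.length_append, word_add]
  constructor
  · exact fun h => List.append_inj h (length_word u _ _)
  · rintro ⟨h1, h2⟩
    rw [h1, h2]

theorem word_eq_wordPow_block_succ_iff (v : ℕ → Letter) (l x k : ℕ) :
    word v x (wordPow (block l) (k + 1)).length = wordPow (block l) (k + 1) ↔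
      ((∀ j < l, v (x + j) = Letter.a) ∧ v (x + l) = Letter.b) ∧
        word v (x + (l + 1)) (wordPow (block l) k).length = wordPow (block l) k := by
  rw [wordPow_succ, word_eq_append_iff, length_block, word_eq_block_iff]

/-- Powers of `a^l b` in `v` correspond to runs of short blocks. -/
theorem HasBlockForm.wordPow_succ_mem_factors_iff (h : HasBlockForm v l₀ l ε) (hv : IsSturmian v)
    (k : ℕ) :
    wordPow (block l) (k + 1) ∈ factors v ↔ ∃ r, longCount ε (r + k) = longCount ε r := by
  have hmono := bPos_strictMono l₀ l ε
  rw [mem_factors_iff]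
  constructor
  · rintro ⟨x, hx⟩
    -- Beyond `l₀`, every `b` is some `bPos`.
    obtain ⟨y, hy, hw⟩ := hv.exists_word_eq x (wordPow (block l) (k + 1)).length l₀
    rw [hx] at hw
    clear hx
    suffices ∃ r, bPos l₀ l ε r = y + l ∧ longCount ε (r + k) = longCount ε r from
      this.imp fun r hr => hr.2
    induction k generalizing y with
    | zero =>
      obtain ⟨⟨_, hb⟩, _⟩ := (word_eq_wordPow_block_succ_iff v l y 0).1 hw
      obtain ⟨r, hr⟩ := h.exists_eq_bPos (by omega) hb
      exact ⟨r, hr.symm, rfl⟩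
    | succ k ih =>
      obtain ⟨⟨_, hb⟩, hw'⟩ := (word_eq_wordPow_block_succ_iff v l y (k + 1)).1 hw
      obtain ⟨s, hs1, hs2⟩ := ih (y + (l + 1)) (by omega) hw'
      obtain ⟨r, hr⟩ := h.exists_eq_bPos (by omega) hb
      have hz : (ε r : ℕ) = 0 := by
        apply h.exponent_eq_zero
        rw [← hr, show y + l + (l + 1) = y + (l + 1) + l by omega, ← hs1]
        exact h.letter_bPos s
      have hrs : r + 1 = s := by
        apply hmono.injective
        rw [hs1, bPos_succ, hz, ← hr]
        omega
      refine ⟨r, hr.symm, ?_⟩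
      rw [show r + (k + 1) = r + 1 + k by omega, hrs, hs2, ← hrs, longCount_succ, hz,
        Nat.add_zero]
  · rintro ⟨r₀, hr₀⟩
    -- The first a^l b of the power is the end of the block before the run. Index at least 1 is
    -- needed because the initial block may be shorter than a^l b.
    obtain ⟨r, hr1, hr⟩ := h.exists_longCount_add_eq hv hr₀ 1
    obtain ⟨r, rfl⟩ := Nat.exists_eq_add_of_le' hr1
    refine ⟨bPos l₀ l ε (r + 1) - l, ?_⟩
    clear hr₀ hr1
    induction k generalizing r with
    | zero =>
      rw [word_eq_wordPow_block_succ_iff]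
      have h1 := bPos_succ l₀ l ε r
      refine ⟨⟨fun j hj => h.letter_between (i := r) (by omega) (by omega), ?_⟩, rfl⟩
      rw [show bPos l₀ l ε (r + 1) - l + l = bPos l₀ l ε (r + 1) by omega]
      exact h.letter_bPos _
    | succ k ih =>
      rw [word_eq_wordPow_block_succ_iff]
      have h1 := bPos_succ l₀ l ε r
      have h2 := longCount_mono ε (show r + 1 + 1 ≤ r + 1 + (k + 1) by omega)
      have h3 := longCount_succ ε (r + 1)
      have h4 := bPos_succ l₀ l ε (r + 1)
      refine ⟨⟨fun j hj => h.letter_between (i := r) (by omega) (by omega), ?_⟩, ?_⟩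
      · rw [show bPos l₀ l ε (r + 1) - l + l = bPos l₀ l ε (r + 1) by omega]
        exact h.letter_bPos _
      · rw [show bPos l₀ l ε (r + 1) - l + (l + 1) = bPos l₀ l ε (r + 1 + 1) - l by omega]
        apply ih
        rw [show r + 1 + 1 + k = r + 1 + (k + 1) by omega]
        omega

end Positions


/-! ### Counting the letters `a` of the image. -/

/-- The number of letters `a` in the prefix of length `n` of the image of `v` under the cellular
automaton with local rule `powerRule (l + 1)`. -/
def caCount (v : ℕ → Letter) (l n : ℕ) : ℕ :=
  Nat.count (cellularAutomaton (powerRule (l + 1)) v · = Letter.a) n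

theorem cellularAutomaton_powerRule_eq_a_iff (v : ℕ → Letter) (l n : ℕ) :
    cellularAutomaton (powerRule (l + 1)) v n = Letter.a ↔ ∀ j ≤ l, v (n + j) = Letter.a := by
  simp only [cellularAutomaton, powerRule, Fin.forall_iff, Nat.lt_succ_iff]
  split_ifs with h
  · simpa using h
  · simpa using h

theorem caCount_succ (v : ℕ → Letter) (l n : ℕ) :
    caCount v l (n + 1) =
      caCount v l n + if cellularAutomaton (powerRule (l + 1)) v n = Letter.a then 1 else 0 :=
  Nat.count_succ _ _

theorem caCount_mono (v : ℕ → Letter) (l : ℕ) : Monotone (caCount v l) := Nat.count_monotone _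

/-- The abelian complexity counts the possible numbers of letters `a`. -/
theorem abelianComplexity_eq_ncard (f : ℕ → Letter) (n : ℕ) :
    abelianComplexity f n =
      (Set.range fun i =>
        Nat.count (f · = Letter.a) (i + n) - Nat.count (f · = Letter.a) i).ncard := by
  have hinj : Set.InjOn (fun g : Letter → ℕ => g Letter.a) (parikh '' factorsOfLength f n) := by
    rw [factorsOfLength_eq_range]
    rintro _ ⟨_, ⟨i, rfl⟩, rfl⟩ _ ⟨_, ⟨j, rfl⟩, rfl⟩ hij
    have hlen : ∀ w : List Letter, w.count Letter.a + w.count Letter.b = w.length := by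
      intro w
      induction w with
      | nil => rfl
      | cons x w ih => cases x <;> simp <;> omega
    have hi := hlen (word f i n)
    have hj := hlen (word f j n)
    rw [length_word] at hi hj
    simp only [parikh] at hij
    funext x
    cases x
    · exact hij
    · simp only [parikh]
      omega
  rw [abelianComplexity, ← hinj.ncard_image, factorsOfLength_eq_range, ← Set.range_comp,
    ← Set.range_comp]
  congr 2
  funext i
  have := count_word f Letter.a i n
  simp only [Function.comp_apply, parikh]
  omega

section

variable {l₀ l : ℕ} {ε : ℕ → Fin 2} {v : ℕ → Letter}

/-- Beyond `l₀` a block has at most l + 1 letters `a`, so a^{l+1} fits only at the start of a long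
one. -/
theorem HasBlockForm.cellularAutomaton_eq_a_iff (h : HasBlockForm v l₀ l ε) {n : ℕ} (hn : l₀ < n) :
    cellularAutomaton (powerRule (l + 1)) v n = Letter.a ↔
      ∃ i, n = bPos l₀ l ε i + 1 ∧ (ε i : ℕ) = 1 := by
  rw [cellularAutomaton_powerRule_eq_a_iff]
  constructor
  · intro ha
    obtain ⟨i, h1, h2⟩ := exists_bPos_le_lt l₀ l ε (n := n - 1) (by omega)
    refine ⟨i, ?_⟩
    have hs := bPos_succ l₀ l ε i
    have : n + l < bPos l₀ l ε (i + 1) := by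
      by_contra! hc
      have := ha (bPos l₀ l ε (i + 1) - n) (by omega)
      rw [show n + (bPos l₀ l ε (i + 1) - n) = bPos l₀ l ε (i + 1) by omega, h.letter_bPos] at this
      cases this
    omega
  · rintro ⟨i, rfl, hi⟩ j hj
    exact h.letter_between (i := i) (by omega) (by rw [bPos_succ]; omega)

theorem HasBlockForm.cellularAutomaton_bPos_iff (h : HasBlockForm v l₀ l ε) (i : ℕ) :
    cellularAutomaton (powerRule (l + 1)) v (bPos l₀ l ε i + 1) = Letter.a ↔ (ε i : ℕ) = 1 := by
  have h0 : l₀ ≤ bPos l₀ l ε i := by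
    simp only [bPos]; omega
  rw [h.cellularAutomaton_eq_a_iff (by omega)]
  constructor
  · rintro ⟨j, hj, he⟩
    rwa [(bPos_strictMono l₀ l ε).injective (Nat.succ_injective hj)]
  · exact fun he => ⟨i, rfl, he⟩

/-- The count can grow only at positions `bPos` + 1. The contribution of the initial block cancels
in differences. -/
theorem HasBlockForm.caCount_eq (h : HasBlockForm v l₀ l ε) {r x : ℕ}
    (h1 : bPos l₀ l ε r + 1 < x) (h2 : x ≤ bPos l₀ l ε (r + 1) + 1) :
    caCount v l x = caCount v l (l₀ + 1) + longCount ε (r + 1) := by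
  have hmono := bPos_strictMono l₀ l ε
  have step : ∀ r, caCount v l (bPos l₀ l ε r + 1) = caCount v l (l₀ + 1) + longCount ε r →
      ∀ x, bPos l₀ l ε r + 2 ≤ x → x ≤ bPos l₀ l ε (r + 1) + 1 →
        caCount v l x = caCount v l (l₀ + 1) + longCount ε (r + 1) := by
    intro r hr x hx
    induction x, hx using Nat.le_induction with
    | base =>
      intro _
      rw [caCount_succ, hr, longCount_succ]
      have := h.cellularAutomaton_bPos_iff r
      split_ifs with h3
      · rw [this.1 h3, Nat.add_assoc]
      · have : (ε r : ℕ) ≠ 1 := fun h4 => h3 (this.2 h4)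
        omega
    | succ x hx ih =>
      intro hx2
      have h0 : l₀ ≤ bPos l₀ l ε r := by
        simp only [bPos]; omega
      have hne : cellularAutomaton (powerRule (l + 1)) v x ≠ Letter.a := by
        rw [Ne, h.cellularAutomaton_eq_a_iff (by omega)]
        rintro ⟨i, hi, -⟩
        have h5 : r < i := by rw [← hmono.lt_iff_lt]; omega
        have h6 : i < r + 1 := by rw [← hmono.lt_iff_lt]; omega
        omega
      rw [caCount_succ, ih (by omega), if_neg hne, Nat.add_zero]
  have hb : ∀ r, caCount v l (bPos l₀ l ε r + 1) = caCount v l (l₀ + 1) + longCount ε r := by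
    intro r
    induction r with
    | zero => simp [bPos_zero, longCount]
    | succ r ih =>
      refine step r ih _ ?_ le_rfl
      rw [bPos_succ]
      omega
  exact step r (hb r) x (by omega) h2

theorem HasBlockForm.caCount_bPos (h : HasBlockForm v l₀ l ε) (r : ℕ) :
    caCount v l (bPos l₀ l ε r + 1) = caCount v l (l₀ + 1) + longCount ε r := by
  rcases r with _ | r
  · simp [bPos_zero, longCount]
  · exact h.caCount_eq (by rw [bPos_succ]; omega) le_rfl

theorem HasBlockForm.exists_caCount_eq (h : HasBlockForm v l₀ l ε) {x : ℕ} (hx : l₀ + 1 < x) :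
    ∃ r, bPos l₀ l ε r + 1 < x ∧ x ≤ bPos l₀ l ε (r + 1) + 1 ∧
      caCount v l x = caCount v l (l₀ + 1) + longCount ε (r + 1) := by
  obtain ⟨r, h1, h2⟩ := exists_bPos_le_lt l₀ l ε (n := x - 2) (by omega)
  exact ⟨r, by omega, by omega, h.caCount_eq (by omega) (by omega)⟩

/-- Every window of the image of a Sturmian word has, arbitrarily far, a window with as many
letters `a`. -/
theorem IsSturmian.exists_caCount_eq (hv : IsSturmian v) (l i n M : ℕ) :
    ∃ j, M ≤ j ∧ caCount v l (j + n) + caCount v l i = caCount v l (i + n) + caCount v l j := by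
  -- An image window of length n depends on n + l letters of `v`.
  obtain ⟨j, hj, hw⟩ := hv.exists_word_eq i (n + l) M
  refine ⟨j, hj, ?_⟩
  rw [word_eq_iff] at hw
  have key : ∀ m ≤ n,
      caCount v l (j + m) + caCount v l i = caCount v l (i + m) + caCount v l j := by
    intro m
    induction m with
    | zero => intro _; exact Nat.add_comm _ _
    | succ m ih =>
      intro hm
      have ih := ih (by omega)
      have heq : cellularAutomaton (powerRule (l + 1)) v (j + m) =
          cellularAutomaton (powerRule (l + 1)) v (i + m) := by
        unfold cellularAutomaton
        congr 1
        funext t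
        rw [Nat.add_assoc, Nat.add_assoc]
        exact hw (m + t) (by omega)
      rw [← Nat.add_assoc, ← Nat.add_assoc, caCount_succ, caCount_succ, heq]
      omega
  exact key n le_rfl

/-- The numbers of letters `a` in two windows of the same length differ by at most `2`. -/
theorem HasBlockForm.caCount_add_le (h : HasBlockForm v l₀ l ε) (hv : IsSturmian v) (i j n : ℕ) :
    caCount v l (i + n) + caCount v l j ≤ caCount v l (j + n) + caCount v l i + 2 := by
  suffices H : ∀ i j, l₀ + 1 < i → l₀ + 1 < j →
      caCount v l (i + n) + caCount v l j ≤ caCount v l (j + n) + caCount v l i + 2 by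
    obtain ⟨i', hi', hi⟩ := hv.exists_caCount_eq l i n (l₀ + 2)
    obtain ⟨j', hj', hj⟩ := hv.exists_caCount_eq l j n (l₀ + 2)
    have := H i' j' (by omega) (by omega)
    omega
  intro i j hi hj
  by_contra! hc
  have hmono := bPos_strictMono l₀ l ε
  obtain ⟨r₁, a1, a2, a3⟩ := h.exists_caCount_eq hi
  obtain ⟨s₁, b1, b2, b3⟩ := h.exists_caCount_eq (x := i + n) (by omega)
  obtain ⟨r₂, c1, c2, c3⟩ := h.exists_caCount_eq hj
  obtain ⟨s₂, d1, d2, d3⟩ := h.exists_caCount_eq (x := j + n) (by omega)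
  have hrs₂ : r₂ < s₂ + 1 := by rw [← hmono.lt_iff_lt]; omega
  have hcount := caCount_mono v l (show j ≤ j + n by omega)
  have hrs₁ : r₁ + 1 < s₁ + 1 := by
    by_contra! hle
    have := longCount_mono ε hle
    omega
  obtain ⟨A, rfl⟩ := Nat.exists_eq_add_of_le (show r₁ + 1 ≤ s₁ by omega)
  obtain ⟨B, rfl⟩ := Nat.exists_eq_add_of_le (show r₂ ≤ s₂ by omega)
  have e1 := bPos_add l₀ l ε (r₁ + 1) A
  have e2 := bPos_add l₀ l ε r₂ (B + 1)
  have e3 := longCount_succ ε (r₁ + 1 + A)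
  have e4 := longCount_succ ε r₂
  rw [← Nat.add_assoc] at e2
  -- Otherwise the first window, with more blocks and more long ones, would be longer than the
  -- second. With A ≤ B, balance over B exponents plus one end block bounds the excess by 2.
  have hAB : A ≤ B := by
    by_contra! hlt
    have := Nat.mul_le_mul_right (l + 1) (show B + 1 ≤ A by omega)
    omega
  have hbal := h.longCount_add_le hv (r₁ + 1) (r₂ + 1) B
  rw [show r₂ + 1 + B = r₂ + B + 1 by omega] at hbal
  rcases hAB.eq_or_lt with rfl | hlt
  · omega
  · have := longCount_mono ε (show r₁ + 1 + A + 1 ≤ r₁ + 1 + B by omega)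
    omega

/-- A window that is not longer than a run of short blocks contains at most one letter `a`. -/
theorem HasBlockForm.caCount_add_le_succ (h : HasBlockForm v l₀ l ε) (hv : IsSturmian v)
    {K r n : ℕ} (hK : longCount ε (r + K) = longCount ε r) (hn : n ≤ K * (l + 1) + 1) (i : ℕ) :
    caCount v l (i + n) ≤ caCount v l i + 1 := by
  suffices H : ∀ i, l₀ + 1 < i → caCount v l (i + n) ≤ caCount v l i + 1 by
    obtain ⟨i', hi', hi⟩ := hv.exists_caCount_eq l i n (l₀ + 2)
    have := H i' (by omega)
    omega
  intro i hi
  by_contra! hc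
  obtain ⟨r₁, a1, a2, a3⟩ := h.exists_caCount_eq hi
  obtain ⟨s₁, b1, b2, b3⟩ := h.exists_caCount_eq (x := i + n) (by omega)
  have hrs₁ : r₁ + 1 < s₁ + 1 := by
    by_contra! hle
    have := longCount_mono ε hle
    omega
  obtain ⟨A, rfl⟩ := Nat.exists_eq_add_of_le (show r₁ + 1 ≤ s₁ by omega)
  have e1 := bPos_add l₀ l ε (r₁ + 1) A
  have e3 := longCount_succ ε (r₁ + 1 + A)
  -- The window spans A blocks, at least one of them long, and one more letter, so n ≥ A(l + 1) + 2.
  -- Two ones among K exponents then contradict balance against K zeros.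
  have hAK : A < K := by
    by_contra! hle
    have := Nat.mul_le_mul_right (l + 1) hle
    omega
  have hbal := h.longCount_add_le hv (r₁ + 1) r K
  have := longCount_mono ε (show r₁ + 1 + A + 1 ≤ r₁ + 1 + K by omega)
  omega

theorem HasBlockForm.exists_exponent_eq_one (h : HasBlockForm v l₀ l ε) (hv : IsSturmian v)
    (M : ℕ) : ∃ i, M ≤ i ∧ (ε i : ℕ) = 1 := by
  by_contra! hc
  refine h.not_eventuallyPeriodic hv ⟨M, 1, one_pos, fun k hk => ?_⟩
  have h1 := hc k hk
  have h2 := hc (k + 1) (by omega)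
  omega

/-- The number of letters `a` in a window of given positive length is not constant. -/
theorem HasBlockForm.exists_caCount_ne (h : HasBlockForm v l₀ l ε) (hv : IsSturmian v)
    {n : ℕ} (hn : 1 ≤ n) :
    ∃ i j, caCount v l (i + n) - caCount v l i ≠ caCount v l (j + n) - caCount v l j := by
  by_contra! hc
  have hmono := bPos_strictMono l₀ l ε
  have hcount : ∀ i,
      caCount v l (i + n) = caCount v l i + (caCount v l (0 + n) - caCount v l 0) := by
    intro i
    have := hc i 0
    have := caCount_mono v l (show i ≤ i + n by omega)
    omega
  set c := caCount v l (0 + n) - caCount v l 0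
  -- A constant count makes the image n-periodic: sliding a window by one drops and gains the same
  -- letter.
  have hper : ∀ i, cellularAutomaton (powerRule (l + 1)) v (i + n) = Letter.a ↔
      cellularAutomaton (powerRule (l + 1)) v i = Letter.a := by
    intro i
    have h1 := hcount i
    have h2 := hcount (i + 1)
    rw [show i + 1 + n = i + n + 1 by omega, caCount_succ, caCount_succ] at h2
    split_ifs at h2 <;> first | omega | simp_all
  have hshift : ∀ r, (ε r : ℕ) = 1 → ∃ q, (ε (r + q) : ℕ) = 1 ∧
      bPos l₀ l ε (r + q) = bPos l₀ l ε r + n ∧ q * (l + 1) + c = n := by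
    intro r hr
    have h0 : l₀ ≤ bPos l₀ l ε r := by
      simp only [bPos]; omega
    have ha := (hper _).2 ((h.cellularAutomaton_bPos_iff r).2 hr)
    obtain ⟨s, hs1, hs2⟩ := (h.cellularAutomaton_eq_a_iff (by omega)).1 ha
    have hrs : r < s := by rw [← hmono.lt_iff_lt]; omega
    obtain ⟨q, rfl⟩ := Nat.exists_eq_add_of_le hrs.le
    refine ⟨q, hs2, by omega, ?_⟩
    have h1 := hcount (bPos l₀ l ε r + 1)
    have h2 := bPos_add l₀ l ε r q
    rw [hs1, h.caCount_bPos, h.caCount_bPos] at h1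
    omega
  obtain ⟨r₀, -, hr₀⟩ := h.exists_exponent_eq_one hv 0
  obtain ⟨q, -, hq1, hq2⟩ := hshift r₀ hr₀
  have hq0 : 0 < q := by
    have : r₀ < r₀ + q := by rw [← hmono.lt_iff_lt]; omega
    omega
  -- The index shift caused by n is the same for all long blocks, so it is a period of `ε`.
  have huniq : ∀ q', q' * (l + 1) + c = n → q' = q := fun q' hq' =>
    Nat.eq_of_mul_eq_mul_right (Nat.succ_pos l) (by rw [Nat.succ_eq_add_one]; omega)
  refine h.not_eventuallyPeriodic hv ⟨n, q, hq0, fun k hk => ?_⟩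
  have hiff : (ε (k + q) : ℕ) = 1 ↔ (ε k : ℕ) = 1 := by
    constructor
    · intro hk1
      have hge : l₀ + k < bPos l₀ l ε (k + q) := by
        have := Nat.le_mul_of_pos_right (k + q) (Nat.succ_pos l)
        rw [Nat.succ_eq_add_one] at this
        simp only [bPos]
        omega
      have ha := (h.cellularAutomaton_bPos_iff (k + q)).2 hk1
      rw [show bPos l₀ l ε (k + q) + 1 = bPos l₀ l ε (k + q) + 1 - n + n by omega, hper,
        h.cellularAutomaton_eq_a_iff (by omega)] at ha
      obtain ⟨s, hs1, hs2⟩ := ha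
      obtain ⟨q', -, hq'1, hq'2⟩ := hshift s hs2
      rw [huniq q' hq'2] at hq'1
      have : s + q = k + q := hmono.injective (by omega)
      rwa [← Nat.add_right_cancel this]
    · intro hk1
      obtain ⟨q', h1, -, h2⟩ := hshift k hk1
      rwa [huniq q' h2] at h1
  omega

/-! ### Extremal distances between long blocks. -/

/-- There is a longest run of short blocks; it is not empty. -/
theorem HasBlockForm.exists_max_run (h : HasBlockForm v l₀ l ε) (hv : IsSturmian v) :
    ∃ K, 1 ≤ K ∧ ∀ k, (∃ r, longCount ε (r + k) = longCount ε r) ↔ k ≤ K := by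
  have hdown : ∀ k k', k ≤ k' → (∃ r, longCount ε (r + k') = longCount ε r) →
      ∃ r, longCount ε (r + k) = longCount ε r := by
    rintro k k' hk ⟨r, hr⟩
    have h1 := longCount_mono ε (show r + k ≤ r + k' by omega)
    have h2 := longCount_mono ε (show r ≤ r + k by omega)
    exact ⟨r, by omega⟩
  -- A stretch of `ε` with two ones and an equally long stretch of zeros would violate balance.
  have hbd : ∃ k, ¬ ∃ r, longCount ε (r + k) = longCount ε r := by
    obtain ⟨i, -, hi⟩ := h.exists_exponent_eq_one hv 0
    obtain ⟨j, hij, hj⟩ := h.exists_exponent_eq_one hv (i + 1)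
    refine ⟨j + 1 - i, ?_⟩
    rintro ⟨r, hr⟩
    have h1 := h.longCount_add_le hv i r (j + 1 - i)
    rw [show i + (j + 1 - i) = j + 1 by omega] at h1
    have h2 := longCount_succ ε i
    have h3 := longCount_succ ε j
    have h4 := longCount_mono ε hij
    omega
  classical
  obtain ⟨N, hN1, hN2⟩ : ∃ N, (¬ ∃ r, longCount ε (r + N) = longCount ε r) ∧
      ∀ m < N, ∃ r, longCount ε (r + m) = longCount ε r :=
    ⟨Nat.find hbd, Nat.find_spec hbd, fun m hm => not_not.1 (Nat.find_min hbd hm)⟩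
  have hN : 2 ≤ N := by
    by_contra! hlt
    have h1 : ∀ r, longCount ε (r + 1) ≠ longCount ε r := fun r hr =>
      hN1 (hdown N 1 (by omega) ⟨r, hr⟩)
    refine h.not_eventuallyPeriodic hv ⟨0, 1, one_pos, fun k _ => ?_⟩
    have h2 := h1 k
    have h3 := h1 (k + 1)
    rw [longCount_succ] at h2 h3
    omega
  refine ⟨N - 1, by omega, fun k => ⟨fun hk => ?_, fun hk => hN2 k (by omega)⟩⟩
  by_contra! hlt
  exact hN1 (hdown N k (by omega) hk)

/-- If `K` is the length of the longest run of short blocks, then there are long blocks whose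
indices differ by `K`. -/
theorem HasBlockForm.exists_long_long (h : HasBlockForm v l₀ l ε) (hv : IsSturmian v) {K : ℕ}
    (hK : ∀ k, (∃ r, longCount ε (r + k) = longCount ε r) ↔ k ≤ K) :
    ∃ i, (ε i : ℕ) = 1 ∧ (ε (i + K) : ℕ) = 1 := by
  by_contra! hc
  obtain ⟨r, hr⟩ := (hK K).2 le_rfl
  -- Balance against K zeros excludes distances below K, and `hc` excludes K. Since K + 1 zeros
  -- never occur, all distances would be K + 1 and `ε` periodic.
  have hdist : ∀ i j, i < j → (ε i : ℕ) = 1 → (ε j : ℕ) = 1 → i + K < j := by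
    intro i j hij hi hj
    by_contra! hle
    rcases hle.eq_or_lt with rfl | hlt
    · exact hc i hi hj
    have h1 := h.longCount_add_le hv i r K
    have h2 := longCount_succ ε i
    have h3 := longCount_succ ε j
    have h4 := longCount_mono ε hij
    have h5 := longCount_mono ε (show j + 1 ≤ i + K by omega)
    simp only [Nat.succ_eq_add_one] at h4
    omega
  have hone : ∀ i, ∃ t ≤ K, (ε (i + t) : ℕ) = 1 := by
    intro i
    by_contra! hz
    have : ∀ t ≤ K + 1, longCount ε (i + t) = longCount ε i := by
      intro t
      induction t with
      | zero => intro _; rfl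
      | succ t ih =>
        intro ht
        have h1 := ih (by omega)
        have h2 := hz t (by omega)
        rw [← Nat.add_assoc, longCount_succ]
        omega
    have := (hK (K + 1)).1 ⟨i, this _ le_rfl⟩
    omega
  refine h.not_eventuallyPeriodic hv ⟨0, K + 1, Nat.succ_pos K, fun i _ => ?_⟩
  have hiff : (ε (i + (K + 1)) : ℕ) = 1 ↔ (ε i : ℕ) = 1 := by
    constructor
    · intro h1
      obtain ⟨t, ht, h2⟩ := hone i
      have := hdist (i + t) (i + (K + 1)) (by omega) h2 h1
      obtain rfl : t = 0 := by omega
      exact h2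
    · intro h1
      obtain ⟨t, ht, h2⟩ := hone (i + 1)
      have := hdist i (i + 1 + t) (by omega) h1 h2
      rwa [show i + (K + 1) = i + 1 + t by omega]
  omega

/-- Consecutive long blocks at maximal distance: after the letter `a` at position `x`, the image
has a run of `(K + 1) * (l + 1)` letters `b`. -/
theorem HasBlockForm.exists_gap (h : HasBlockForm v l₀ l ε) (hv : IsSturmian v) {K : ℕ}
    (hK : ∀ k, (∃ r, longCount ε (r + k) = longCount ε r) ↔ k ≤ K) :
    ∃ x, caCount v l (x + 1) = caCount v l x + 1 ∧
      caCount v l (x + 1 + (K + 1) * (l + 1)) = caCount v l (x + 1) := by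
  obtain ⟨r₀, hr₀⟩ := (hK K).2 le_rfl
  obtain ⟨s, hs, hr⟩ := h.exists_longCount_add_eq hv hr₀ 1
  obtain ⟨r, rfl⟩ := Nat.exists_eq_add_of_le' hs
  have h1 := longCount_succ ε r
  have h2 := longCount_succ ε (r + 1 + K)
  -- By maximality the run is enclosed by ones, at `r` and `r + 1 + K`.
  have he1 : (ε r : ℕ) = 1 := by
    by_contra hne
    have := (hK (K + 1)).1 ⟨r, by rw [show r + (K + 1) = r + 1 + K by omega]; omega⟩
    omega
  have he2 : (ε (r + 1 + K) : ℕ) = 1 := by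
    by_contra hne
    have := (hK (K + 1)).1 ⟨r + 1, by rw [← Nat.add_assoc]; omega⟩
    omega
  have h3 := bPos_add l₀ l ε (r + 1) K
  have h4 := bPos_succ l₀ l ε r
  refine ⟨bPos l₀ l ε r + 1, ?_, ?_⟩
  · rw [caCount_succ, if_pos ((h.cellularAutomaton_bPos_iff r).2 he1)]
  · rw [Nat.add_mul K 1, Nat.one_mul, h.caCount_eq (r := r) (x := _ + 1 + 1) (by omega)
      (by omega), ← hr, ← h.caCount_bPos]
    congr 1
    omega

end

end SturmianCA

/-! ### The three ranges of n. -/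

theorem mainTheorem3 (v : ℕ → SturmianCA.Letter) (hv : SturmianCA.IsASturmian v)
    (l₀ l : ℕ) (ε : ℕ → Fin 2) (hform : SturmianCA.HasBlockForm v l₀ l ε) :
    ∃ k₀ : ℕ,
      IsGreatest {k : ℕ | SturmianCA.wordPow (SturmianCA.block l) k ∈ SturmianCA.factors v} k₀ ∧
      ∃ n₀ : ℕ, n₀ = k₀ * (l + 1) ∧ l < n₀ ∧
        ∀ n : ℕ, 1 ≤ n →
          (n ≤ n₀ - l →
            SturmianCA.abelianComplexity
              (SturmianCA.cellularAutomaton (SturmianCA.powerRule (l + 1)) v) n = 2) ∧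
          (n₀ - l + 1 ≤ n → n ≤ n₀ →
            SturmianCA.abelianComplexity
              (SturmianCA.cellularAutomaton (SturmianCA.powerRule (l + 1)) v) n = 3) ∧
          (n₀ < n →
            SturmianCA.abelianComplexity
              (SturmianCA.cellularAutomaton (SturmianCA.powerRule (l + 1)) v) n = 2 ∨
            SturmianCA.abelianComplexity
              (SturmianCA.cellularAutomaton (SturmianCA.powerRule (l + 1)) v) n = 3) := by
  open SturmianCA in
  have hS := hv.1
  obtain ⟨K, hK1, hK⟩ := hform.exists_max_run hS
  obtain ⟨r, hr⟩ := (hK K).2 le_rfl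
  obtain ⟨x, hx1, hx2⟩ := hform.exists_gap hS hK
  have hmono := caCount_mono v l
  have hn₀ : (K + 1) * (l + 1) = K * (l + 1) + 1 + l := by
    rw [Nat.add_mul, Nat.one_mul]; omega
  refine ⟨K + 1, ⟨?_, ?_⟩, (K + 1) * (l + 1), rfl, by omega, ?_⟩
  · exact (hform.wordPow_succ_mem_factors_iff hS K).2 ((hK K).2 le_rfl)
  · rintro k hk
    rcases k with _ | k
    · exact Nat.zero_le _
    · have := (hK k).1 ((hform.wordPow_succ_mem_factors_iff hS k).1 hk)
      omega
  intro n hn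
  rw [abelianComplexity_eq_ncard]
  set C := Set.range fun i => caCount v l (i + n) - caCount v l i with hC
  change (n ≤ _ → C.ncard = 2) ∧ (_ → _ → C.ncard = 3) ∧ (_ → C.ncard = 2 ∨ C.ncard = 3)
  have hzero : n ≤ (K + 1) * (l + 1) → 0 ∈ C := by
    intro hle
    refine ⟨x + 1, ?_⟩
    have := hmono (show x + 1 + n ≤ x + 1 + (K + 1) * (l + 1) by omega)
    simp only
    omega
  have hone : n ≤ (K + 1) * (l + 1) → 1 ∈ C := by
    intro hle
    refine ⟨x, ?_⟩
    have h1 := hmono (show x + n ≤ x + 1 + (K + 1) * (l + 1) by omega)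
    have h2 := hmono (show x + 1 ≤ x + n by omega)
    simp only
    omega
  have hdiff : ∀ c ∈ C, ∀ d ∈ C, c ≤ d + 2 := by
    rintro _ ⟨i, rfl⟩ _ ⟨j, rfl⟩
    have h1 := hform.caCount_add_le hS i j n
    have h2 := hmono (show i ≤ i + n by omega)
    have h3 := hmono (show j ≤ j + n by omega)
    simp only
    omega
  refine ⟨fun hle => ?_, fun hge hle => ?_, fun hlt => ?_⟩
  · have : C = {0, 1} := by
      apply Set.Subset.antisymm
      · rintro _ ⟨i, rfl⟩
        have := hform.caCount_add_le_succ hS hr (n := n) (by omega) i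
        simp only [Set.mem_insert_iff, Set.mem_singleton_iff]
        omega
      · rintro _ (rfl | rfl)
        · exact hzero (by omega)
        · exact hone (by omega)
    rw [this, Set.ncard_pair (by decide)]
  -- Balance makes `i` the only long block among the K from `i` on, so the two letters `a` are K(l +
  -- 1) + 1 apart and both lie in the window.
  · have htwo : 2 ∈ C := by
      obtain ⟨i, hi1, hi2⟩ := hform.exists_long_long hS hK
      refine ⟨bPos l₀ l ε i + 1, ?_⟩
      have h1 := bPos_add l₀ l ε i K
      have h2 := longCount_succ ε i
      have h3 := longCount_succ ε (i + K)
      have h4 := longCount_mono ε (show i + 1 ≤ i + K by omega)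
      have h5 := hform.longCount_add_le hS i r K
      have h6 := hmono (show bPos l₀ l ε (i + K) + 1 + 1 ≤ bPos l₀ l ε i + 1 + n by omega)
      have h7 := hform.caCount_bPos i
      have h8 := hform.caCount_eq (r := i + K) (x := bPos l₀ l ε (i + K) + 1 + 1) (by omega)
        (by rw [bPos_succ]; omega)
      have h9 : caCount v l (bPos l₀ l ε i + 1 + n) - caCount v l (bPos l₀ l ε i + 1) ≤ 0 + 2 :=
        hdiff _ ⟨_, rfl⟩ _ (hzero hle)
      simp only
      omega
    have : C = {0, 1, 2} := by
      apply Set.Subset.antisymm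
      · intro c hc
        have := hdiff c hc 0 (hzero hle)
        simp only [Set.mem_insert_iff, Set.mem_singleton_iff]
        omega
      · rintro _ (rfl | rfl | rfl)
        · exact hzero hle
        · exact hone hle
        · exact htwo
    rw [this, Set.ncard_eq_three]
    exact ⟨0, 1, 2, by decide, by decide, by decide, rfl⟩
  · obtain ⟨m, hm, hmin⟩ : ∃ m ∈ C, ∀ c ∈ C, m ≤ c := by
      have hne : C.Nonempty := Set.range_nonempty _
      exact ⟨sInf C, Nat.sInf_mem hne, fun c hc => Nat.sInf_le hc⟩
    have hsub : C ⊆ (Finset.Icc m (m + 2) : Set ℕ) := by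
      intro c hc
      have h1 := hdiff c hc m hm
      have h2 := hmin c hc
      simp only [Finset.coe_Icc, Set.mem_Icc]
      omega
    have hfin : C.Finite := (Finset.finite_toSet _).subset hsub
    have hle3 := Set.ncard_le_ncard hsub (Finset.finite_toSet _)
    rw [Set.ncard_coe_finset, Nat.card_Icc] at hle3
    obtain ⟨i, j, hij⟩ := hform.exists_caCount_ne hS hn
    have hlt := (Set.one_lt_ncard_iff hfin).2 ⟨_, _, ⟨i, rfl⟩, ⟨j, rfl⟩, hij⟩
    omega
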